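/- All objects are smooth and global. Let $W\subset V$ be finite-dimensional real vector spaces of smooth vector fields on $\mathbb{R}^n$ with $[W,W]\subset W$ and $[W,V]\subset V$ (a quasi-Lie scheme $S(W,V)$), and let $\mathcal V$ be the set of $t$-dependent vector fields taking values in $V$, i.e. of smooth curves $t\in\mathbb{R}\mapsto X_t\in V$. Let $\mathcal G_W$ be the set of generalised flows of $t$-dependent vector fields taking values in $W$, i.e. of the smooth families $g=(g_t)_{t\in\mathbb{R}}$ of diffeomorphisms of $\mathbb{R}^n$ with $g_0=\mathrm{id}$ and $\partial_t g_t=Y_t\circ g_t$ for a smooth curve $t\mapsto Y_t\in W$. Such a $g$ acts on $\mathcal V$ by $(g_\bigstar X)_t=\frac{\partial g_t}{\partial t}\circ g_t^{-1}+g_{t*}X_t$. For an integer $p\ge 0$ put $T^pV=V^{p+1}$ and ${\bf t}^p_tX=(X_t,\frac{dX_t}{dt},\dots,\frac{d^pX_t}{dt^p})\in T^pV$ for $X\in\mathcal V$, $t\in\mathbb{R}$ (and likewise for $W$). A map $F:\mathcal V\to C^\infty(\mathbb{R})$ is a *quasi-Lie invariant of order $p$ for $S(W,V)$* if $F(g_\bigstar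 X)=F(X)$ for all $g\in\mathcal G_W$ and $X\in\mathcal V$, and there is a (necessarily unique) function $\varphi_F:T^pV\to\mathbb{R}$ such that $[F(X)](t)=\varphi_F({\bf t}^p_tX)$ for all $X\in\mathcal V$ and $t\in\mathbb{R}$. **Theorem.** Let $G$ be a connected (Hausdorff, finite-dimensional) Lie group with a smooth action on $\mathbb{R}^n$ such that sending an element of $T_eG$ to its fundamental vector field is a bijection of $T_eG$ onto $W$. Let $F$ be a quasi-Lie invariant of order $p$ for $S(W,V)$. Then: 1. $g_*V\subset V$ for every $g\in G$, the map $$\mathcal J^p:G\times T^pV\to T^pV,\qquad \mathcal J^p(g;(X_0,\dots,X_p))=(g_*X_0,\dots,g_*X_p),$$ is smooth, and $\varphi_F$ is a first integral of every fundamental vector field of this action. 2. Let $T^p_{p-1}W\simeq W$ be the abelian Lie group of those ${\bf t}^p_{t_0}Y=(Y_0,\dots,Y_p)\in T^pW$ with ${\bf t}^{p-1}_{t_0}Y=(Y_0,\dots,Y_{p-1})=0$ (no condition if $p=0$). Then $\varphi_F$ is a first integral of every fundamental vector field of the action $$\mathcal T^p:T^p_{p-1}W\times T^pV\to T^pV,\qquad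 \mathcal T^p({\bf t}^p_{t_0}Y;{\bf t}^p_{t_0}X)={\bf t}^p_{t_0}(Y+X).$$ Here a function $\varphi$ is a first integral of a vector field $Z$ if $\varphi$ is constant along the integral curves of $Z$ (defined on open intervals) and $Z\varphi=0$ at every point where $\varphi$ is differentiable. -/

import Mathlib

open scoped Manifold ContDiff

namespace QuasiLie

/-- The phase space `ℝⁿ`. -/
abbrev RSpace (n : ℕ) : Type := EuclideanSpace ℝ (Fin n)

/-- The real vector space `𝔛(ℝⁿ)` of smooth vector fields on `ℝⁿ`. -/
abbrev VField (n : ℕ) : Type :=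
  C^∞⟮𝓘(ℝ, RSpace n), RSpace n; 𝓘(ℝ, RSpace n), RSpace n⟯

/-- The group of smooth diffeomorphisms of `ℝⁿ` (as a type). -/
abbrev Diffeo (n : ℕ) : Type :=
  Diffeomorph 𝓘(ℝ, RSpace n) 𝓘(ℝ, RSpace n) (RSpace n) (RSpace n) ∞

/-- The Lie bracket of two smooth vector fields. -/
noncomputable def bracket {n : ℕ} (X Y : VField n) : VField n :=
  ⟨VectorField.lieBracket ℝ X Y, by
    have hX : ContDiff ℝ ∞ X := X.contMDiff.contDiff
    have hY : ContDiff ℝ ∞ Y := Y.contMDiff.contDiff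
    refine ContDiff.contMDiff ?_
    unfold VectorField.lieBracket
    exact ((hY.fderiv_right (m := ∞) (by simp)).clm_apply hX).sub
      ((hX.fderiv_right (m := ∞) (by simp)).clm_apply hY)⟩

/-- The pushforward `f_* X` of a vector field `X` by a diffeomorphism `f`. -/
noncomputable def pushforward {n : ℕ} (f : Diffeo n) (X : VField n) : VField n :=
  ⟨fun y => fderiv ℝ f (f.symm y) (X (f.symm y)), by
    have hX : ContDiff ℝ ∞ X := X.contMDiff.contDiff
    have hf : ContDiff ℝ ∞ f := f.contMDiff.contDiff
    have hs : ContDiff ℝ ∞ f.symm := f.symm.contMDiff.contDiff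
    exact (((hf.fderiv_right (m := ∞) (by simp)).comp hs).clm_apply (hX.comp hs)).contMDiff⟩

/-- A finite-dimensional space of vector fields is normed by its coordinates in a basis. All norms
on it are equivalent, so nothing below (smoothness, derivatives) depends on this choice. -/
noncomputable instance instNormedAddCommGroupFields {n : ℕ} (V : Submodule ℝ (VField n))
    [FiniteDimensional ℝ V] : NormedAddCommGroup V :=
  NormedAddCommGroup.induced V (Fin (Module.finrank ℝ V) → ℝ)
    (Module.finBasis ℝ V).equivFun (Module.finBasis ℝ V).equivFun.injective

noncomputable instance instNormedSpaceFields {n : ℕ} (V : Submodule ℝ (VField n))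
    [FiniteDimensional ℝ V] : NormedSpace ℝ V :=
  NormedSpace.induced ℝ V (Fin (Module.finrank ℝ V) → ℝ) (Module.finBasis ℝ V).equivFun

/-- A quasi-Lie scheme `S(W, V)` on `ℝⁿ`: finite-dimensional spaces `W ⊆ V` of vector fields with
`[W, W] ⊆ W` and `[W, V] ⊆ V`. -/
structure Scheme (n : ℕ) where
  /-- the Lie algebra `W` -/
  W : Submodule ℝ (VField n)
  /-- the vector space `V` -/
  V : Submodule ℝ (VField n)
  finiteDimensional_W : FiniteDimensional ℝ W
  finiteDimensional_V : FiniteDimensional ℝ V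
  le : W ≤ V
  bracket_mem_W : ∀ X ∈ W, ∀ Y ∈ W, bracket X Y ∈ W
  bracket_mem_V : ∀ X ∈ W, ∀ Y ∈ V, bracket X Y ∈ V

attribute [instance] Scheme.finiteDimensional_W Scheme.finiteDimensional_V

/-- The quasi-Lie family attached to a finite-dimensional space `V` of vector fields: the
`t`-dependent vector fields taking values in `V`, that is, the smooth curves in `V`. -/
abbrev Family {n : ℕ} (V : Submodule ℝ (VField n)) [FiniteDimensional ℝ V] : Type :=
  C^∞⟮𝓘(ℝ, ℝ), ℝ; 𝓘(ℝ, V), V⟯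

/-- The space `C^∞(ℝ)`. -/
abbrev SmoothFun : Type := C^∞⟮𝓘(ℝ, ℝ), ℝ; 𝓘(ℝ, ℝ), ℝ⟯

/-- The generalised flow `g` of a `t`-dependent vector field `Y`: `g₀ = id`, and `t ↦ g_t(x)` is
the solution of `dx/dt = Y(t, x)` starting at `x`. -/
structure IsGeneralisedFlow {n : ℕ} (Y : ℝ → VField n) (g : ℝ → Diffeo n) : Prop where
  smooth : ContDiff ℝ ∞ (fun q : ℝ × RSpace n => g q.1 q.2)
  zero : ∀ x, g 0 x = x
  solves : ∀ t x, HasDerivAt (fun s => g s x) (Y t (g t x)) t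

/-- The set `𝒢_W` of generalised flows of `t`-dependent vector fields with values in `W`. -/
def flowGroup {n : ℕ} (W : Submodule ℝ (VField n)) [FiniteDimensional ℝ W] :
    Set (ℝ → Diffeo n) :=
  {g | ∃ Y : Family W, IsGeneralisedFlow (fun t => (Y t : VField n)) g}

/-- `(g_★ X)_t = (∂g_t/∂t) ∘ g_t⁻¹ + (g_t)_* X_t`. -/
noncomputable def star {n : ℕ} (g : ℝ → Diffeo n) (X : ℝ → VField n) (t : ℝ) :
    RSpace n → RSpace n :=
  fun y => deriv (fun s => g s ((g t).symm y)) t + pushforward (g t) (X t) y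

/-- `F` is a quasi-Lie invariant: `F(g_★ X) = F(X)` for all `g ∈ 𝒢_W` and all `X` in the family
of `V`. Here `X'` is the element `g_★ X` of that family. -/
def IsInvariant {n : ℕ} (S : Scheme n) (F : Family S.V → SmoothFun) : Prop :=
  ∀ g ∈ flowGroup S.W, ∀ X X' : Family S.V,
    (∀ t y, (X' t : VField n) y = star g (fun s => (X s : VField n)) t y) → F X' = F X

/-- The `p`-order tangent space `T^p V` of a vector space `V` in its linear coordinates
`(X_0, …, X_p)`. -/
abbrev TangentPow (p : ℕ) (V : Type*) : Type _ := Fin (p + 1) → V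

/-- The `p`-order tangent vector `𝐭^p_t X = (X_t, dX_t/dt, …, d^pX_t/dt^p)`. -/
noncomputable def jet (p : ℕ) {n : ℕ} {V : Submodule ℝ (VField n)} [FiniteDimensional ℝ V]
    (X : Family V) (t : ℝ) : TangentPow p V :=
  fun k => iteratedDeriv (k : ℕ) (fun s => X s) t

/-- `F` is a quasi-Lie invariant of order `p`, with associated function `φ = φ_F`. -/
def IsInvariantOfOrder {n : ℕ} (S : Scheme n) (p : ℕ) (F : Family S.V → SmoothFun)
    (φ : TangentPow p S.V → ℝ) : Prop :=
  IsInvariant S F ∧ ∀ (X : Family S.V) (t : ℝ), F X t = φ (jet p X t)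

/-- The fundamental vector field, on a normed space `M`, of an element `v` of the tangent space at
the neutral element `e` of a Lie group `G`, for the action `act` of `G` on `M`:
`m ↦ T_e(g ↦ act g m)(v)`. -/
noncomputable def fundamentalField {𝔤 : Type*} [NormedAddCommGroup 𝔤] [NormedSpace ℝ 𝔤]
    {G : Type*} [TopologicalSpace G] [ChartedSpace 𝔤 G]
    {M : Type*} [NormedAddCommGroup M] [NormedSpace ℝ M]
    (e : G) (act : G → M → M) (v : TangentSpace 𝓘(ℝ, 𝔤) e) : M → M :=
  fun m => mfderiv 𝓘(ℝ, 𝔤) 𝓘(ℝ, M) (fun g => act g m) e v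

/-- `φ` is a first integral of the vector field `Z`: it is constant along the integral curves of
`Z`, and `Z φ = 0` at every point where `φ` is differentiable. -/
structure IsFirstIntegral {M : Type*} [NormedAddCommGroup M] [NormedSpace ℝ M]
    (φ : M → ℝ) (Z : M → M) : Prop where
  const_along : ∀ (a b : ℝ) (γ : ℝ → M), IsIntegralCurveOn γ (fun _ => Z) (Set.Ioo a b) →
    ∀ s ∈ Set.Ioo a b, ∀ s' ∈ Set.Ioo a b, φ (γ s) = φ (γ s')
  deriv_eq_zero : ∀ m, DifferentiableAt ℝ φ m → fderiv ℝ φ m (Z m) = 0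

/-- A smooth (left) action of a Lie group `G` on `ℝⁿ`. -/
structure LieAction (𝔤 : Type*) [NormedAddCommGroup 𝔤] [NormedSpace ℝ 𝔤]
    (G : Type*) [TopologicalSpace G] [ChartedSpace 𝔤 G] [Group G] (n : ℕ) where
  toHom : G →* Equiv.Perm (RSpace n)
  smooth : ContMDiff (𝓘(ℝ, 𝔤).prod 𝓘(ℝ, RSpace n)) 𝓘(ℝ, RSpace n) ∞
    (fun q : G × RSpace n => toHom q.1 q.2)

namespace LieAction

variable {𝔤 : Type*} [NormedAddCommGroup 𝔤] [NormedSpace ℝ 𝔤]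
  {G : Type*} [TopologicalSpace G] [ChartedSpace 𝔤 G] [Group G] {n : ℕ}

/-- The diffeomorphism `Φ_g` of `ℝⁿ`. -/
def diffeo (Φ : LieAction 𝔤 G n) (g : G) : Diffeo n where
  toEquiv := Φ.toHom g
  contMDiff_toFun := Φ.smooth.comp (contMDiff_const.prodMk contMDiff_id)
  contMDiff_invFun := by
    have h : ContMDiff 𝓘(ℝ, RSpace n) 𝓘(ℝ, RSpace n) ∞ (fun x => Φ.toHom g⁻¹ x) :=
      Φ.smooth.comp (contMDiff_const.prodMk contMDiff_id)
    rw [map_inv] at h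
    exact h

/-- `Φ` integrates `W`: the map sending an element of `T_eG` to its fundamental vector field is a
bijection of `T_eG` onto `W`. -/
def Integrates (Φ : LieAction 𝔤 G n) (W : Submodule ℝ (VField n)) : Prop :=
  Set.BijOn (fundamentalField (𝔤 := 𝔤) (1 : G) (fun g x => Φ.toHom g x)) Set.univ
    {f : RSpace n → RSpace n | ∃ Y ∈ W, (Y : RSpace n → RSpace n) = f}

/-- The pushforwards by the maps `Φ_g` map `V` to itself. -/
def Preserves (Φ : LieAction 𝔤 G n) (V : Submodule ℝ (VField n)) : Prop :=
  ∀ (g : G), ∀ X ∈ V, pushforward (Φ.diffeo g) X ∈ V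

/-- The action `𝒥^p` of `G` on `T^p V`: `(g; X_0, …, X_p) ↦ (g_* X_0, …, g_* X_p)`. -/
noncomputable def jetAction (Φ : LieAction 𝔤 G n) {V : Submodule ℝ (VField n)}
    (hV : Φ.Preserves V) (p : ℕ) (g : G) (j : TangentPow p V) : TangentPow p V :=
  fun k => ⟨pushforward (Φ.diffeo g) (j k), hV g (j k) (j k).2⟩

end LieAction

/-- The abelian Lie group `T^p_{p-1} W` of those `𝐭^p Y ∈ T^p W` with `𝐭^{p-1} Y = 0`. -/
def topJets (p : ℕ) {n : ℕ} (W : Submodule ℝ (VField n)) [FiniteDimensional ℝ W] :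
    Submodule ℝ (TangentPow p W) where
  carrier := {w | ∀ k : Fin (p + 1), (k : ℕ) < p → w k = 0}
  add_mem' := fun {a b} ha hb k hk => by rw [Pi.add_apply, ha k hk, hb k hk, add_zero]
  zero_mem' := fun _ _ => rfl
  smul_mem' := fun c a ha k hk => by rw [Pi.smul_apply, ha k hk, smul_zero]

/-- The action `𝒯^p` of `T^p_{p-1} W` on `T^p V`: `(𝐭^p Y; 𝐭^p X) ↦ 𝐭^p (Y + X)`. -/
noncomputable def translationAction {n : ℕ} (S : Scheme n) (p : ℕ) (w : topJets p S.W)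
    (j : TangentPow p S.V) : TangentPow p S.V :=
  fun k => Submodule.inclusion S.le (w.1 k) + j k

end QuasiLie

/-! Both parts follow from full invariance: $\varphi_F(\mathcal J^p(g;j))=\varphi_F(j)$ and
$\varphi_F(\mathcal T^p(w;j))=\varphi_F(j)$. A smooth curve $c$ in $G$ with $c(0)=e$ acts on
$\mathbb R^n$ as a generalised flow, because its velocity, right-translated to $e$, gives a curve
$Y_t\in W$. It transforms $X$ into $Y_t+c(t)_*X_t$ (`exists_star`). Every jet is realised by some
$X$ (`exists_jet_eq`), so invariance of $F$ becomes an identity for $\varphi_F$ once $c$ is chosen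
well.

For $\mathcal J^p$, take $g$ near $e$ and $c$ equal to $g$ near $t=1$. There $Y=0$, so the jet at
$1$ is merely pushed forward by $g$; connectedness of $G$ gives all $g$ (`apply_jetAction`). For
$\mathcal T^p$, take $c(t)=C(t^{p+1}/(p+1)!)$, with $C$ having initial velocity corresponding to
$w_p$. Then $Y$ has $p$-jet $(0,\dots,0,w_p)$ at $0$ and $c(t)_*-\mathrm{id}$ vanishes to order
$p+1$, so the jet is only translated (`apply_translationAction`).

That $g_*V\subset V$ comes from $\frac{d}{dt}c(t)_*X=c(t)_*[Z_t,X]$ with $Z_t\in W$: a linear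
equation that can be solved inside $V$, with uniqueness by Grönwall (`pushforward_mem_of_curve`).

No regularity of $\varphi_F$ is assumed, so constancy along an integral curve cannot be obtained by
differentiating $\varphi_F$: the curve is shown to stay, locally, in a group orbit
(`isFirstIntegral_of_invariant`). -/

namespace QuasiLie

/-! ### Finite-dimensional spaces of fields, controlled by point evaluations. -/

section Evaluation

variable {n : ℕ} (V : Submodule ℝ (VField n)) [FiniteDimensional ℝ V]

/-- Evaluation of the vector fields in `V` at a point. -/
noncomputable def evalAt (x : RSpace n) : V →L[ℝ] RSpace n :=
  LinearMap.toContinuousLinearMap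
    { toFun := fun X => (X : VField n) x
      map_add' := fun _ _ => rfl
      map_smul' := fun _ _ => rfl }

@[simp]
lemma evalAt_apply (x : RSpace n) (X : V) : evalAt V x X = (X : VField n) x := rfl

/-- The fields in a finite-dimensional space can be reconstructed linearly from their values at
finitely many points. -/
lemma exists_sampling : ∃ (s : Finset (RSpace n)) (T : RSpace n → RSpace n →L[ℝ] V),
    ∀ X : V, ∑ x ∈ s, T x ((X : VField n) x) = X := by
  classical
  let K : RSpace n → Submodule ℝ V := fun x => LinearMap.ker (evalAt V x).toLinearMap
  -- A finite set of points with minimal common kernel: adding a point cannot shrink it, so a field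
  -- vanishing on `s` vanishes everywhere.
  obtain ⟨-, ⟨s, rfl⟩, hs⟩ := (wellFounded_lt (α := Submodule ℝ V)).has_min
    (Set.range fun s : Finset (RSpace n) => s.inf K) ⟨_, ⟨∅, rfl⟩⟩
  have hker : ∀ X : V, (∀ x ∈ s, (X : VField n) x = 0) → X = 0 := by
    intro X hX
    have hXs : X ∈ s.inf K := by
      rw [Submodule.mem_finsetInf]
      exact fun x hx => hX x hx
    refine Subtype.ext (DFunLike.ext _ _ fun x => ?_)
    have hle : s.inf K ≤ K x := by
      by_contra h
      refine hs _ ⟨insert x s, rfl⟩ ?_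
      simp only [Finset.inf_insert]
      exact inf_lt_right.2 h
    exact hle hXs
  let L : V →ₗ[ℝ] (s → RSpace n) := LinearMap.pi fun x => (evalAt V x).toLinearMap
  have hL : LinearMap.ker L = ⊥ := by
    rw [LinearMap.ker_eq_bot']
    intro X hX
    exact hker X fun x hx => congrFun hX ⟨x, hx⟩
  obtain ⟨g, hg⟩ := L.exists_leftInverse_of_injective hL
  refine ⟨s, fun x => if h : x ∈ s then LinearMap.toContinuousLinearMap
    (g ∘ₗ LinearMap.single ℝ (fun _ : s => RSpace n) ⟨x, h⟩) else 0, fun X => ?_⟩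
  rw [← Finset.sum_coe_sort]
  have h1 := LinearMap.congr_fun hg X
  simp only [LinearMap.comp_apply, LinearMap.id_apply] at h1
  conv_rhs => rw [← h1, ← Finset.univ_sum_single (L X), map_sum]
  refine Finset.sum_congr rfl fun x _ => ?_
  simp only [dif_pos x.2]
  rfl

variable {V}

/-- A map into a finite-dimensional space of fields is smooth if it is so pointwise. -/
lemma contMDiff_of_eval {E' H' M : Type*} [NormedAddCommGroup E'] [NormedSpace ℝ E']
    [TopologicalSpace H'] {I : ModelWithCorners ℝ E' H'} [TopologicalSpace M] [ChartedSpace H' M]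
    {f : M → V} (hf : ∀ x, ContMDiff I 𝓘(ℝ, RSpace n) ∞ fun m => (f m : VField n) x) :
    ContMDiff I 𝓘(ℝ, V) ∞ f := by
  obtain ⟨s, T, hT⟩ := exists_sampling V
  have : f = fun m => ∑ x ∈ s, T x ((f m : VField n) x) := funext fun m => (hT _).symm
  rw [this]
  exact contMDiff_finsetSum fun x _ => (T x).contMDiff.comp (hf x)

lemma contDiff_of_eval {f : ℝ → V} (hf : ∀ x, ContDiff ℝ ∞ fun m => (f m : VField n) x) :
    ContDiff ℝ ∞ f :=
  contMDiff_iff_contDiff.1 (contMDiff_of_eval fun x => (hf x).contMDiff)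

lemma contMDiff_eval : ContMDiff (𝓘(ℝ, V).prod 𝓘(ℝ, RSpace n)) 𝓘(ℝ, RSpace n) ∞
    fun q : V × RSpace n => (q.1 : VField n) q.2 := by
  have h : (fun q : V × RSpace n => (q.1 : VField n) q.2) = fun q =>
      ∑ i, (Module.finBasis ℝ V).coord i q.1 • ((Module.finBasis ℝ V i : V) : VField n) q.2 := by
    funext q
    conv_lhs => rw [← (Module.finBasis ℝ V).sum_repr q.1]
    rw [← evalAt_apply, map_sum]
    simp
  rw [h]
  refine contMDiff_finsetSum fun i _ => ?_
  have h1 := (LinearMap.toContinuousLinearMap ((Module.finBasis ℝ V).coord i)).contMDiff.comp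
    (contMDiff_fst (I := 𝓘(ℝ, V)) (J := 𝓘(ℝ, RSpace n)) (M := V) (N := RSpace n) (n := ∞))
  have h2 := ((Module.finBasis ℝ V i : V) : VField n).contMDiff.comp
    (contMDiff_snd (I := 𝓘(ℝ, V)) (J := 𝓘(ℝ, RSpace n)) (M := V) (N := RSpace n) (n := ∞))
  exact h1.smul h2

end Evaluation

/-! ### Derivatives of operator-valued curves. -/

section OperatorValued

variable {E F : Type*} [NormedAddCommGroup E] [NormedSpace ℝ E] [FiniteDimensional ℝ E]
  [NormedAddCommGroup F] [NormedSpace ℝ F]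

/-- In finite dimension an operator is a fixed linear expression in its values on a basis, so strong
differentiability is norm differentiability. -/
lemma hasDerivAt_clm_of_apply {A : ℝ → E →L[ℝ] F} {A' : E →L[ℝ] F} {t : ℝ}
    (h : ∀ x, HasDerivAt (fun s => A s x) (A' x) t) : HasDerivAt A A' t := by
  let b := Module.finBasis ℝ E
  let S : (i : Fin (Module.finrank ℝ E)) → F →L[ℝ] (E →L[ℝ] F) := fun i =>
    ContinuousLinearMap.smulRightL ℝ E F (LinearMap.toContinuousLinearMap (b.coord i))
  have key : ∀ B : E →L[ℝ] F, B = ∑ i, S i (B (b i)) := by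
    intro B
    ext x
    conv_lhs => rw [← b.sum_repr x, map_sum]
    simp [S]
  have : A = fun s => ∑ i, S i (A s (b i)) := funext fun s => key _
  rw [this, key A']
  exact HasDerivAt.fun_sum fun i _ => (S i).hasFDerivAt.comp_hasDerivAt t (h (b i))

end OperatorValued

/-! ### The Lie derivative as a bracket. -/

section LieDerivative

variable {E : Type*} [NormedAddCommGroup E] [NormedSpace ℝ E]

/-- The derivative of the pullback of a vector field along a smooth family of diffeomorphisms, at a
time where the family is the identity, is the Lie bracket with the velocity of the family. -/
lemma hasDerivAt_pullback {g P : ℝ × E → E} {t₀ : ℝ}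
    (hP : ContDiff ℝ ∞ P) (hPg : ∀ t x, P (t, g (t, x)) = x) (h0 : ∀ x, g (t₀, x) = x)
    {X Y : E → E} (hY : ∀ x, HasDerivAt (fun s => g (s, x)) (Y x) t₀)
    (hX : Differentiable ℝ X) (z : E) :
    HasDerivAt (fun s => fderiv ℝ (fun x => P (s, x)) (g (s, z)) (X (g (s, z))))
      (VectorField.lieBracket ℝ Y X z) t₀ := by
  have hdP : Differentiable ℝ P := hP.differentiable (by simp)
  have hddP : Differentiable ℝ (fderiv ℝ P) :=
    (hP.fderiv_right (m := ∞) (by simp)).differentiable (by simp)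
  have hP0 : ∀ y, P (t₀, y) = y := fun y => by simpa only [h0] using hPg t₀ y
  let R : (ℝ × E →L[ℝ] E) →L[ℝ] (E →L[ℝ] E) :=
    (ContinuousLinearMap.compL ℝ E (ℝ × E) E).flip (ContinuousLinearMap.inr ℝ ℝ E)
  let H : ℝ × E → E →L[ℝ] E := fun q => R (fderiv ℝ P q)
  have hHw : ∀ q w, H q w = fderiv ℝ P q (0, w) := fun q w => rfl
  have hpair : ∀ (s : ℝ) (y : E), HasFDerivAt (fun x : E => (s, x))
      (ContinuousLinearMap.inr ℝ ℝ E) y := fun s y => hasFDerivAt_prodMk_right s y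
  have hH : ∀ s y, fderiv ℝ (fun x => P (s, x)) y = H (s, y) := fun s y =>
    ((hdP (s, y)).hasFDerivAt.comp y (hpair s y)).fderiv
  have hH0 : ∀ y, H (t₀, y) = ContinuousLinearMap.id ℝ E := fun y => by
    rw [← hH, funext hP0]
    exact fderiv_fun_id
  have hdH : Differentiable ℝ H := R.differentiable.comp hddP
  have hdH' : ∀ q v w, fderiv ℝ H q v w = fderiv ℝ (fderiv ℝ P) q v (0, w) := fun q v w => by
    have : fderiv ℝ H q = R.comp (fderiv ℝ (fderiv ℝ P) q) :=
      (R.hasFDerivAt.comp q (hddP q).hasFDerivAt).fderiv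
    rw [this]
    rfl
  have hcurve : ∀ y, HasDerivAt (fun s => (s, g (s, y))) ((1 : ℝ), Y y) t₀ := fun y =>
    (hasDerivAt_id t₀).prodMk (hY y)
  -- Differentiate $P(s,g(s,y))=y$ at $t_0$, where the spatial derivative of $P$ is the identity.
  have hPt : ∀ y, fderiv ℝ P (t₀, y) (1, 0) = -Y y := fun y => by
    have h1 : HasDerivAt (fun s => P (s, g (s, y))) (fderiv ℝ P (t₀, g (t₀, y)) (1, Y y)) t₀ :=
      (hdP _).hasFDerivAt.comp_hasDerivAt t₀ (hcurve y)
    have h2 : fderiv ℝ P (t₀, y) (1, Y y) = 0 := by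
      rw [h0] at h1
      refine h1.unique ?_
      simp only [hPg]
      exact hasDerivAt_const _ _
    have h3 : fderiv ℝ P (t₀, y) (0, Y y) = Y y := by
      rw [← hHw, hH0]; rfl
    have h4 : ((1 : ℝ), Y y) = (1, 0) + (0, Y y) := by simp
    rw [h4, map_add, h3] at h2
    exact eq_neg_of_add_eq_zero_left h2
  have hHy : ∀ w, fderiv ℝ H (t₀, z) (0, w) = 0 := fun w => by
    have h1 : HasFDerivAt (fun x => H (t₀, x))
      ((fderiv ℝ H (t₀, z)).comp (ContinuousLinearMap.inr ℝ ℝ E)) z :=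
      (hdH (t₀, z)).hasFDerivAt.comp z (hpair t₀ z)
    have h2 : HasFDerivAt (fun x => H (t₀, x)) (0 : E →L[ℝ] E →L[ℝ] E) z := by
      simp only [hH0]
      exact hasFDerivAt_const _ _
    exact DFunLike.congr_fun (h1.unique h2) w
  -- Symmetry of the second derivative of $P$ turns the time derivative of its spatial differential
  -- into the spatial derivative of `hPt`.
  have hHt : ∀ w, fderiv ℝ H (t₀, z) (1, 0) w = -fderiv ℝ Y z w := fun w => by
    rw [hdH', (hP.contDiffAt.isSymmSndFDerivAt (by
      rw [minSmoothness_of_isRCLikeNormedField]; exact WithTop.coe_le_coe.2 le_top)).eq]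
    have h1 : HasFDerivAt (fun x => fderiv ℝ P (t₀, x) (1, 0))
      ((ContinuousLinearMap.apply ℝ E ((1 : ℝ), (0 : E))).comp
        ((fderiv ℝ (fderiv ℝ P) (t₀, z)).comp (ContinuousLinearMap.inr ℝ ℝ E))) z :=
      (ContinuousLinearMap.apply ℝ E ((1 : ℝ), (0 : E))).hasFDerivAt.comp z
        ((hddP (t₀, z)).hasFDerivAt.comp z (hpair t₀ z))
    have h2 := h1.fderiv
    simp only [hPt] at h2
    rw [fderiv_fun_neg] at h2
    exact (DFunLike.congr_fun h2 w).symm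
  have hXg : HasDerivAt (fun s => X (g (s, z))) (fderiv ℝ X z (Y z)) t₀ := by
    have := (hX (g (t₀, z))).hasFDerivAt.comp_hasDerivAt t₀ (hY z)
    rwa [h0] at this
  have hHg : HasDerivAt (fun s => H (s, g (s, z))) (fderiv ℝ H (t₀, z) (1, Y z)) t₀ := by
    have := (hdH (t₀, g (t₀, z))).hasFDerivAt.comp_hasDerivAt t₀ (hcurve z)
    rwa [h0] at this
  have := hHg.clm_apply hXg
  simp only [hH]
  convert! this using 1
  have h4 : ((1 : ℝ), Y z) = (1, 0) + (0, Y z) := by simp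
  rw [h0, hH0, h4, map_add, hHy, add_zero, hHt, VectorField.lieBracket]
  simp only [ContinuousLinearMap.id_apply]
  abel

end LieDerivative

/-! ### Pushforward by a group action: functoriality and smoothness. -/

section Pushforward

variable {n : ℕ}

lemma pushforward_add (f : Diffeo n) (X Y : VField n) :
    pushforward f (X + Y) = pushforward f X + pushforward f Y :=
  DFunLike.ext _ _ fun y => (fderiv ℝ f (f.symm y)).map_add _ _

lemma pushforward_smul (f : Diffeo n) (c : ℝ) (X : VField n) :
    pushforward f (c • X) = c • pushforward f X :=
  DFunLike.ext _ _ fun y => (fderiv ℝ f (f.symm y)).map_smul _ _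

variable {𝔤 : Type*} [NormedAddCommGroup 𝔤] [NormedSpace ℝ 𝔤]
  {G : Type*} [TopologicalSpace G] [ChartedSpace 𝔤 G] [Group G] (Φ : LieAction 𝔤 G n)

namespace LieAction

lemma inv_smul_smul (g : G) (x : RSpace n) : Φ.toHom g⁻¹ (Φ.toHom g x) = x := by
  rw [map_inv]
  exact (Φ.toHom g).symm_apply_apply x

lemma smul_inv_smul (g : G) (x : RSpace n) : Φ.toHom g (Φ.toHom g⁻¹ x) = x := by
  rw [map_inv]
  exact (Φ.toHom g).apply_symm_apply x

lemma mul_smul (g h : G) (x : RSpace n) : Φ.toHom (g * h) x = Φ.toHom g (Φ.toHom h x) := by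
  rw [map_mul, Equiv.Perm.mul_apply]

lemma pushforward_apply (g : G) (X : VField n) (y : RSpace n) :
    pushforward (Φ.diffeo g) X y =
      fderiv ℝ (fun x => Φ.toHom g x) (Φ.toHom g⁻¹ y) (X (Φ.toHom g⁻¹ y)) := by
  rw [map_inv]; rfl

lemma differentiable (g : G) : Differentiable ℝ fun x => Φ.toHom g x :=
  (Φ.diffeo g).contMDiff.contDiff.differentiable (by simp)

lemma pushforward_one (X : VField n) : pushforward (Φ.diffeo 1) X = X := by
  refine DFunLike.ext _ _ fun y => ?_
  rw [pushforward_apply, inv_one, map_one]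
  simp only [Equiv.Perm.coe_one, id_eq, fderiv_fun_id, ContinuousLinearMap.id_apply]

lemma pushforward_mul (g h : G) (X : VField n) :
    pushforward (Φ.diffeo (g * h)) X = pushforward (Φ.diffeo g) (pushforward (Φ.diffeo h) X) := by
  refine DFunLike.ext _ _ fun y => ?_
  rw [pushforward_apply, pushforward_apply, pushforward_apply, mul_inv_rev, mul_smul]
  have h1 : (fun x => Φ.toHom (g * h) x) = (fun x => Φ.toHom g x) ∘ fun x => Φ.toHom h x :=
    funext fun x => Φ.mul_smul g h x
  rw [h1, fderiv_comp _ (Φ.differentiable g _) (Φ.differentiable h _), smul_inv_smul]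
  rfl

/-- The pushforward of a field of `V` at a point is smooth in the group element and the field. -/
lemma contMDiff_pushforward_eval [LieGroup 𝓘(ℝ, 𝔤) ∞ G] {V : Submodule ℝ (VField n)}
    [FiniteDimensional ℝ V] (y : RSpace n) :
    ContMDiff (𝓘(ℝ, 𝔤).prod 𝓘(ℝ, V)) 𝓘(ℝ, RSpace n) ∞
      fun q : G × V => pushforward (Φ.diffeo q.1) q.2 y := by
  have hinv : ContMDiff 𝓘(ℝ, 𝔤) 𝓘(ℝ, RSpace n) ∞ fun g : G => Φ.toHom g⁻¹ y :=
    Φ.smooth.comp ((contMDiff_inv 𝓘(ℝ, 𝔤) ∞).prodMk contMDiff_const)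
  have hD : ContMDiff 𝓘(ℝ, 𝔤) 𝓘(ℝ, RSpace n →L[ℝ] RSpace n) ∞
      fun g : G => fderiv ℝ (fun x => Φ.toHom g x) (Φ.toHom g⁻¹ y) := by
    intro g
    have := ContMDiffAt.mfderiv (m := ∞) (n := ∞) (x₀ := g) (fun (g : G) x => Φ.toHom g x)
      (fun g : G => Φ.toHom g⁻¹ y) Φ.smooth.contMDiffAt hinv.contMDiffAt (by simp)
    have h1 := inTangentCoordinates_model_space (I := 𝓘(ℝ, RSpace n)) (I' := 𝓘(ℝ, RSpace n))
      (fun g : G => Φ.toHom g⁻¹ y) (fun g : G => Φ.toHom g (Φ.toHom g⁻¹ y))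
      (fun g : G => mfderiv 𝓘(ℝ, RSpace n) 𝓘(ℝ, RSpace n) (fun x => Φ.toHom g x) (Φ.toHom g⁻¹ y)) g
    have h2 := this.congr_of_eventuallyEq (Filter.Eventually.of_forall fun g' => (congrFun h1 g').symm)
    simp only [mfderiv_eq_fderiv] at h2
    exact h2
  have hfst : ContMDiff (𝓘(ℝ, 𝔤).prod 𝓘(ℝ, V)) 𝓘(ℝ, 𝔤) ∞ (Prod.fst : G × V → G) := contMDiff_fst
  have hX : ContMDiff (𝓘(ℝ, 𝔤).prod 𝓘(ℝ, V)) 𝓘(ℝ, RSpace n) ∞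
      fun q : G × V => (q.2 : VField n) (Φ.toHom q.1⁻¹ y) :=
    contMDiff_eval.comp (contMDiff_snd.prodMk (hinv.comp hfst))
  simp only [pushforward_apply]
  exact (hD.comp hfst).clm_apply hX

end LieAction

end Pushforward

/-! ### The bracket representation of $W$ on $V$. -/

section Bracket

variable {n : ℕ}

lemma VField.differentiableAt (X : VField n) (x : RSpace n) : DifferentiableAt ℝ X x :=
  X.contMDiff.contDiff.differentiable (by simp) x

lemma bracket_add_left (X X' Y : VField n) :
    bracket (X + X') Y = bracket X Y + bracket X' Y :=
  DFunLike.ext _ _ fun x =>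
    VectorField.lieBracket_add_left (X.differentiableAt x) (X'.differentiableAt x)

lemma bracket_add_right (X Y Y' : VField n) :
    bracket X (Y + Y') = bracket X Y + bracket X Y' :=
  DFunLike.ext _ _ fun x =>
    VectorField.lieBracket_add_right (Y.differentiableAt x) (Y'.differentiableAt x)

lemma bracket_smul_left (c : ℝ) (X Y : VField n) : bracket (c • X) Y = c • bracket X Y :=
  DFunLike.ext _ _ fun x => VectorField.lieBracket_const_smul_left (X.differentiableAt x)

lemma bracket_smul_right (c : ℝ) (X Y : VField n) : bracket X (c • Y) = c • bracket X Y :=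
  DFunLike.ext _ _ fun x => VectorField.lieBracket_const_smul_right (Y.differentiableAt x)

/-- The representation of `W` on `V` by Lie brackets. -/
noncomputable def Scheme.ad (S : Scheme n) : S.W →L[ℝ] S.V →L[ℝ] S.V :=
  LinearMap.toContinuousLinearMap
    ((LinearMap.toContinuousLinearMap : (S.V →ₗ[ℝ] S.V) ≃ₗ[ℝ] (S.V →L[ℝ] S.V)).toLinearMap ∘ₗ
      LinearMap.mk₂ ℝ (fun (Y : S.W) (X : S.V) =>
        (⟨bracket (Y : VField n) X, S.bracket_mem_V Y Y.2 X X.2⟩ : S.V))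
        (fun _ _ _ => Subtype.ext (bracket_add_left _ _ _))
        (fun _ _ _ => Subtype.ext (bracket_smul_left _ _ _))
        (fun _ _ _ => Subtype.ext (bracket_add_right _ _ _))
        (fun _ _ _ => Subtype.ext (bracket_smul_right _ _ _)))

end Bracket

/-! ### Flows generated by curves in $G$, and preservation of $V$. -/

section Curves

variable {n : ℕ} {𝔤 : Type*} [NormedAddCommGroup 𝔤] [NormedSpace ℝ 𝔤]
  {G : Type*} [TopologicalSpace G] [ChartedSpace 𝔤 G]

/-- The velocity of a curve in a manifold modelled on `𝔤`. -/
noncomputable def velocity (d : ℝ → G) (t : ℝ) : 𝔤 :=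
  mfderiv 𝓘(ℝ, ℝ) 𝓘(ℝ, 𝔤) d t (1 : ℝ)

lemma hasDerivAt_comp_curve {M : Type*} [NormedAddCommGroup M] [NormedSpace ℝ M] {f : G → M}
    {d : ℝ → G} {t : ℝ} {e : G} (hd : MDifferentiableAt 𝓘(ℝ, ℝ) 𝓘(ℝ, 𝔤) d t) (he : d t = e)
    (hf : MDifferentiableAt 𝓘(ℝ, 𝔤) 𝓘(ℝ, M) f e) :
    HasDerivAt (fun s => f (d s)) (mfderiv 𝓘(ℝ, 𝔤) 𝓘(ℝ, M) f e (velocity (𝔤 := 𝔤) d t)) t := by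
  subst he
  have h := hf.hasMFDerivAt.comp t hd.hasMFDerivAt
  let L : ℝ →L[ℝ] M := (mfderiv 𝓘(ℝ, 𝔤) 𝓘(ℝ, M) f (d t)).comp (mfderiv 𝓘(ℝ, ℝ) 𝓘(ℝ, 𝔤) d t)
  have h' : HasFDerivAt (f ∘ d) L t := hasMFDerivAt_iff_hasFDerivAt.1 h
  exact h'.hasDerivAt

variable [Group G] {Φ : LieAction 𝔤 G n}

namespace LieAction

lemma mdifferentiableAt_orbit (x : RSpace n) (g : G) :
    MDifferentiableAt 𝓘(ℝ, 𝔤) 𝓘(ℝ, RSpace n) (fun g => Φ.toHom g x) g :=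
  ((Φ.smooth.comp (contMDiff_id.prodMk contMDiff_const)).contMDiffAt).mdifferentiableAt (by simp)

variable {c : ℝ → G} (hc : ContMDiff 𝓘(ℝ, ℝ) 𝓘(ℝ, 𝔤) ∞ c)

include hc

lemma contDiff_curve : ContDiff ℝ ∞ fun q : ℝ × RSpace n => Φ.toHom (c q.1) q.2 := by
  rw [← contMDiff_iff_contDiff, modelWithCornersSelf_prod, ← chartedSpaceSelf_prod]
  exact Φ.smooth.comp ((hc.comp contMDiff_fst).prodMk contMDiff_snd)

variable [LieGroup 𝓘(ℝ, 𝔤) ∞ G]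

/-- The velocity field of the family of diffeomorphisms defined by a smooth curve in `G`. -/
lemma exists_velocityField {W : Submodule ℝ (VField n)} [FiniteDimensional ℝ W]
    (hΦ : Φ.Integrates W) : ∃ Y : Family W, ∀ t x,
      HasDerivAt (fun s => Φ.toHom (c s) x) ((Y t : VField n) (Φ.toHom (c t) x)) t := by
  have key : ∀ t, ∃ Y : W, ∀ x,
      HasDerivAt (fun s => Φ.toHom (c s) x) ((Y : VField n) (Φ.toHom (c t) x)) t := by
    intro t
    -- Right translation makes the curve pass through $e$ at time $t$, so its velocity there is a
    -- tangent vector that `hΦ` sends into $W$.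
    let d : ℝ → G := fun s => c s * (c t)⁻¹
    have hd : ContMDiff 𝓘(ℝ, ℝ) 𝓘(ℝ, 𝔤) ∞ d := hc.mul contMDiff_const
    obtain ⟨Y, hYW, hY⟩ := hΦ.mapsTo (Set.mem_univ (velocity (𝔤 := 𝔤) d t))
    refine ⟨⟨Y, hYW⟩, fun x => ?_⟩
    have h := hasDerivAt_comp_curve (e := (1 : G)) (hd.mdifferentiableAt (by simp))
      (mul_inv_cancel (c t)) (mdifferentiableAt_orbit (Φ := Φ) (Φ.toHom (c t) x) 1)
    have h1 : ∀ s, Φ.toHom (d s) (Φ.toHom (c t) x) = Φ.toHom (c s) x := fun s => by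
      rw [← Φ.mul_smul, inv_mul_cancel_right]
    simp only [h1] at h
    have h2 : Y (Φ.toHom (c t) x) = mfderiv 𝓘(ℝ, 𝔤) 𝓘(ℝ, RSpace n)
      (fun g => Φ.toHom g (Φ.toHom (c t) x)) 1 (velocity (𝔤 := 𝔤) d t) :=
      congrFun hY (Φ.toHom (c t) x)
    rw [← h2] at h
    exact h
  choose Y hY using key
  have hsm : ContDiff ℝ ∞ Y := by
    refine contDiff_of_eval fun x => ?_
    have hinv : ContDiff ℝ ∞ fun t => Φ.toHom (c t)⁻¹ x :=
      (contDiff_curve (Φ := Φ) hc.inv).comp (contDiff_id.prodMk contDiff_const)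
    have hact := contDiff_curve (Φ := Φ) hc
    have : (fun t => (Y t : VField n) x) = fun t =>
        fderiv ℝ (fun q : ℝ × RSpace n => Φ.toHom (c q.1) q.2) (t, Φ.toHom (c t)⁻¹ x) (1, 0) := by
      funext t
      have h1 := hY t (Φ.toHom (c t)⁻¹ x)
      rw [Φ.smul_inv_smul] at h1
      exact h1.unique (((hact.differentiable (by simp)) _).hasFDerivAt.comp_hasDerivAt t
        ((hasDerivAt_id t).prodMk (hasDerivAt_const t _)))
    rw [this]
    exact ((hact.fderiv_right (m := ∞) (by simp)).comp (contDiff_id.prodMk hinv)).clm_apply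
      contDiff_const
  exact ⟨⟨Y, hsm.contMDiff⟩, hY⟩

/-- The pushforwards along a smooth curve in `G` satisfy a linear differential equation. -/
lemma exists_hasDerivAt_pushforward {W : Submodule ℝ (VField n)} [FiniteDimensional ℝ W]
    (hΦ : Φ.Integrates W) : ∃ Z : Family W, ∀ (X : VField n) t y,
      HasDerivAt (fun s => pushforward (Φ.diffeo (c s)) X y)
        (pushforward (Φ.diffeo (c t)) (bracket (Z t : VField n) X) y) t := by
  obtain ⟨Z, hZ⟩ := exists_velocityField hc.inv hΦ
  refine ⟨Z, fun X t y => ?_⟩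
  have hP : ContDiff ℝ ∞ fun q : ℝ × RSpace n => Φ.toHom ((c t)⁻¹ * c q.1) q.2 :=
    contDiff_curve (contMDiff_const.mul hc)
  -- The family $c(t)^{-1}c(s)$ is the identity at $s=t$; composing with the fixed pushforward by
  -- $c(t)$ then gives the derivative at any time.
  have h := hasDerivAt_pullback (g := fun q : ℝ × RSpace n => Φ.toHom ((c q.1)⁻¹ * c t) q.2)
    (t₀ := t) hP (Y := (Z t : VField n)) (X := X)
    (fun s x => by
      rw [← Φ.mul_smul, mul_assoc, mul_inv_cancel_left, inv_mul_cancel, map_one]; rfl)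
    (fun x => by rw [inv_mul_cancel, map_one]; rfl)
    (fun x => by
      have := hZ t (Φ.toHom (c t) x)
      rw [Φ.inv_smul_smul] at this
      simpa only [Φ.mul_smul] using this) (fun x => X.differentiableAt x) (Φ.toHom (c t)⁻¹ y)
  have h2 := (fderiv ℝ (fun x => Φ.toHom (c t) x) (Φ.toHom (c t)⁻¹ y)).hasFDerivAt.comp_hasDerivAt
    t h
  rw [Φ.pushforward_apply]
  convert! h2 using 1
  funext s
  conv_lhs => rw [← mul_inv_cancel_left (c t) (c s), Φ.pushforward_mul, Φ.pushforward_apply,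
    Φ.pushforward_apply]
  simp only [mul_inv_rev, inv_inv]
  rfl

/-- The pushforward of a field in $V$ is not yet known to lie in $V$. Sampling its values yields a
candidate `U` in $V$; at each point, the true value and that of the candidate solve the same linear
equation with the same initial value. -/
lemma pushforward_mem_of_curve (S : Scheme n) (hΦ : Φ.Integrates S.W) (h0 : c 0 = 1)
    {X : VField n} (hX : X ∈ S.V) : pushforward (Φ.diffeo (c 1)) X ∈ S.V := by
  obtain ⟨Z, hZ⟩ := exists_hasDerivAt_pushforward hc hΦ
  obtain ⟨s, T, hT⟩ := exists_sampling S.V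
  let u : ℝ → RSpace n → S.V →L[ℝ] RSpace n := fun t x => LinearMap.toContinuousLinearMap
    { toFun := fun X => pushforward (Φ.diffeo (c t)) X x
      map_add' := fun X Y => DFunLike.congr_fun (pushforward_add _ (X : VField n) Y) x
      map_smul' := fun a X => DFunLike.congr_fun (pushforward_smul _ a (X : VField n)) x }
  have hu : ∀ t x, HasDerivAt (fun t => u t x) ((u t x).comp (S.ad (Z t))) t := fun t x =>
    hasDerivAt_clm_of_apply fun X => hZ X t x
  let U : ℝ → S.V →L[ℝ] S.V := fun t => ∑ z ∈ s, (T z).comp (u t z)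
  have hU : ∀ t, HasDerivAt U ((U t).comp (S.ad (Z t))) t := fun t => by
    have : (U t).comp (S.ad (Z t)) = ∑ z ∈ s, (T z).comp ((u t z).comp (S.ad (Z t))) := by
      simp only [U, ContinuousLinearMap.finsetSum_comp, ContinuousLinearMap.comp_assoc]
    rw [this]
    exact HasDerivAt.fun_sum fun z _ => (ContinuousLinearMap.compL ℝ S.V (RSpace n) S.V
      (T z)).hasFDerivAt.comp_hasDerivAt t (hu t z)
  obtain ⟨K, hK⟩ := (isCompact_Icc (a := (0 : ℝ)) (b := 1)).exists_bound_of_continuousOn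
    (S.ad.continuous.comp Z.contMDiff.continuous).continuousOn
  have hr : ∀ x, u 1 x = (evalAt S.V x).comp (U 1) := fun x => by
    let r : ℝ → S.V →L[ℝ] RSpace n := fun t => u t x - (evalAt S.V x).comp (U t)
    have hr' : ∀ t, HasDerivAt r ((r t).comp (S.ad (Z t))) t := fun t => by
      have := (hu t x).sub ((ContinuousLinearMap.compL ℝ S.V S.V (RSpace n)
        (evalAt S.V x)).hasFDerivAt.comp_hasDerivAt t (hU t))
      convert! this using 1
    have hu0 : ∀ z, u 0 z = evalAt S.V z := fun z => by
      ext1 X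
      change pushforward (Φ.diffeo (c 0)) X z = _
      rw [h0, Φ.pushforward_one]
      rfl
    have hr0 : r 0 = 0 := by
      ext1 X
      have hU0 : U 0 X = X := by
        simp only [U, _root_.sum_apply, ContinuousLinearMap.comp_apply, hu0]
        exact hT X
      simp only [r, _root_.sub_apply, ContinuousLinearMap.comp_apply, hU0, hu0,
        sub_self, _root_.zero_apply]
    -- Zero initial error and zero forcing force `r` to vanish.
    have := norm_le_gronwallBound_of_norm_deriv_right_le (f := r) (δ := 0) (K := K) (ε := 0)
      (a := 0) (b := 1) (fun t _ => (hr' t).continuousAt.continuousWithinAt)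
      (fun t _ => (hr' t).hasDerivWithinAt) (by rw [hr0, norm_zero])
      (fun t ht => by
        rw [add_zero, mul_comm]
        exact (ContinuousLinearMap.opNorm_comp_le _ _).trans (mul_le_mul_of_nonneg_left
          (hK t (Set.Ico_subset_Icc_self ht)) (norm_nonneg _))) 1 (by simp)
    rw [gronwallBound_ε0_δ0] at this
    exact sub_eq_zero.1 (norm_le_zero_iff.1 this)
  have : pushforward (Φ.diffeo (c 1)) X = U 1 ⟨X, hX⟩ :=
    DFunLike.ext _ _ fun x => DFunLike.congr_fun (hr x) (⟨X, hX⟩ : S.V)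
  rw [this]
  exact (U 1 _).2

end LieAction

end Curves

/-! ### Smooth curves in $G$ with prescribed behaviour. -/

section Curves

variable {𝔤 : Type*} [NormedAddCommGroup 𝔤] [NormedSpace ℝ 𝔤]
  {G : Type*} [TopologicalSpace G] [ChartedSpace 𝔤 G]

lemma contMDiff_chart_symm_comp [IsManifold 𝓘(ℝ, 𝔤) ∞ G] (x : G) {η : ℝ → 𝔤}
    (hη : ContDiff ℝ ∞ η) (ht : ∀ t, η t ∈ (extChartAt 𝓘(ℝ, 𝔤) x).target) :
    ContMDiff 𝓘(ℝ, ℝ) 𝓘(ℝ, 𝔤) ∞ fun t => (extChartAt 𝓘(ℝ, 𝔤) x).symm (η t) :=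
  (contMDiffOn_extChartAt_symm x).comp_contMDiff hη.contMDiff ht

/-- Points close to `x` are joined to `x` by smooth curves that become constant. -/
lemma eventually_exists_curve [IsManifold 𝓘(ℝ, 𝔤) ∞ G] (x : G) :
    ∀ᶠ h in nhds x, ∃ c : ℝ → G, ContMDiff 𝓘(ℝ, ℝ) 𝓘(ℝ, 𝔤) ∞ c ∧ c 0 = x ∧
      ∀ᶠ t in nhds (1 : ℝ), c t = h := by
  set χ := extChartAt 𝓘(ℝ, 𝔤) x with hχ
  obtain ⟨r, hr, hball⟩ := Metric.mem_nhds_iff.1 (extChartAt_target_mem_nhds (I := 𝓘(ℝ, 𝔤)) x)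
  filter_upwards [extChartAt_source_mem_nhds (I := 𝓘(ℝ, 𝔤)) x,
    continuousAt_extChartAt (I := 𝓘(ℝ, 𝔤)) x (Metric.ball_mem_nhds _ hr)] with h hs hb
  -- The factor $2$ makes the transition end at $t=1/2$, so the curve is constant on a neighbourhood
  -- of $1$.
  let η : ℝ → 𝔤 := fun t => χ x + Real.smoothTransition (2 * t) • (χ h - χ x)
  have hη : ContDiff ℝ ∞ η := contDiff_const.add
    ((Real.smoothTransition.contDiff.comp (contDiff_const.mul contDiff_id)).smul contDiff_const)
  refine ⟨fun t => χ.symm (η t), contMDiff_chart_symm_comp x hη fun t => hball ?_, ?_, ?_⟩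
  · exact (convex_ball _ _).add_smul_sub_mem (Metric.mem_ball_self hr) hb
      ⟨Real.smoothTransition.nonneg _, Real.smoothTransition.le_one _⟩
  · simp only [η, mul_zero, Real.smoothTransition.zero, zero_smul, add_zero]
    exact extChartAt_to_inv x
  · filter_upwards [lt_mem_nhds (show (1 / 2 : ℝ) < 1 by norm_num)] with t ht
    have : Real.smoothTransition (2 * t) = 1 :=
      Real.smoothTransition.one_of_one_le (by linarith)
    simp only [η, this, one_smul, add_sub_cancel]
    exact χ.left_inv hs

/-- Every tangent vector is the velocity of a smooth curve defined on the whole line. -/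
lemma exists_curve_velocity [IsManifold 𝓘(ℝ, 𝔤) ∞ G] (x : G) (v : 𝔤) :
    ∃ c : ℝ → G, ContMDiff 𝓘(ℝ, ℝ) 𝓘(ℝ, 𝔤) ∞ c ∧ c 0 = x ∧ velocity (𝔤 := 𝔤) c 0 = v := by
  set χ := extChartAt 𝓘(ℝ, 𝔤) x with hχ
  obtain ⟨r, hr, hball⟩ := Metric.mem_nhds_iff.1 (extChartAt_target_mem_nhds (I := 𝓘(ℝ, 𝔤)) x)
  set ε := r / (‖v‖ + 1) with hε
  have hv : 0 < ‖v‖ + 1 := by positivity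
  have hε0 : 0 < ε := by positivity
  -- The sine has the right initial slope yet stays bounded, and $\varepsilon\|v\|<r$ keeps the
  -- curve inside the chart for all times.
  let η : ℝ → 𝔤 := fun t => χ x + (ε * Real.sin (t / ε)) • v
  have hη : ContDiff ℝ ∞ η := contDiff_const.add
    ((contDiff_const.mul (Real.contDiff_sin.comp (contDiff_id.div_const ε))).smul contDiff_const)
  have hη0 : η 0 = χ x := by simp [η]
  have hη' : HasDerivAt η v 0 := by
    have h1 : HasDerivAt (fun t : ℝ => ε * Real.sin (t / ε)) 1 0 := by
      have := (((hasDerivAt_id (0 : ℝ)).div_const ε).sin).const_mul ε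
      simpa [hε0.ne'] using this
    have h2 := (h1.smul_const v).const_add (χ x)
    rwa [one_smul] at h2
  have hmem : ∀ t, η t ∈ χ.target := fun t => hball <| by
    rw [mem_ball_iff_norm, add_sub_cancel_left, norm_smul, norm_mul, Real.norm_of_nonneg hε0.le]
    have h1 : ‖Real.sin (t / ε)‖ ≤ 1 := Real.abs_sin_le_one _
    calc ε * ‖Real.sin (t / ε)‖ * ‖v‖ ≤ ε * 1 * ‖v‖ := by gcongr
      _ < ε * (‖v‖ + 1) := by rw [mul_one]; exact mul_lt_mul_of_pos_left (lt_add_one _) hε0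
      _ = r := div_mul_cancel₀ _ hv.ne'
  have hc := contMDiff_chart_symm_comp x hη hmem
  refine ⟨_, hc, ?_, ?_⟩
  · change χ.symm (η 0) = x
    rw [hη0]
    exact extChartAt_to_inv x
  · have : IsManifold 𝓘(ℝ, 𝔤) 1 G := IsManifold.of_le (n := ∞) (by simp)
    have hx : χ.symm (η 0) = x := by rw [hη0]; exact extChartAt_to_inv x
    have hd : MDifferentiableAt 𝓘(ℝ, 𝔤) 𝓘(ℝ, 𝔤) χ x := mdifferentiableAt_extChartAt (by simp)
    have h := hasDerivAt_comp_curve (hc.mdifferentiableAt (by simp) (x := 0)) hx hd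
    rw [mfderiv_extChartAt_self] at h
    have h2 : (fun s => χ (χ.symm (η s))) = η := funext fun s => χ.right_inv (hmem s)
    rw [h2] at h
    exact h.unique hη'

end Curves

/-! ### From a neighbourhood of $e$ to all of $G$; the linear operators $g_*$ on $V$. -/

section Group

variable {𝔤 : Type*} [NormedAddCommGroup 𝔤] [NormedSpace ℝ 𝔤]
  {G : Type*} [TopologicalSpace G] [ChartedSpace 𝔤 G] [Group G]

/-- A neighbourhood of the neutral element generates a connected topological group. -/
lemma forall_of_eventually_nhds_one [IsTopologicalGroup G] [ConnectedSpace G] {P : G → Prop}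
    (hmul : ∀ g h, P g → P h → P (g * h)) (hinv : ∀ g, P g → P g⁻¹)
    (h1 : ∀ᶠ g in nhds 1, P g) (g : G) : P g := by
  let H : Subgroup G :=
    { carrier := {g | P g}
      mul_mem' := fun {a b} => hmul a b
      one_mem' := h1.self_of_nhds
      inv_mem' := fun {a} => hinv a }
  have hH : IsOpen (H : Set G) := H.isOpen_of_mem_nhds (g := 1) h1
  have : (H : Set G) = Set.univ :=
    IsClopen.eq_univ ⟨H.isClosed_of_isOpen hH, hH⟩ ⟨1, H.one_mem⟩
  exact this.ge (Set.mem_univ g)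

variable {n : ℕ} {Φ : LieAction 𝔤 G n}

namespace LieAction

lemma Integrates.preserves [LieGroup 𝓘(ℝ, 𝔤) ∞ G] [ConnectedSpace G] {S : Scheme n} (hΦ : Φ.Integrates S.W) :
    Φ.Preserves S.V := by
  have := topologicalGroup_of_lieGroup 𝓘(ℝ, 𝔤) ∞ (G := G)
  have hloc : ∀ᶠ g in nhds (1 : G), ∀ X ∈ S.V, pushforward (Φ.diffeo g) X ∈ S.V := by
    filter_upwards [eventually_exists_curve (𝔤 := 𝔤) (1 : G)]
    rintro g ⟨c, hc, h0, h1⟩ X hX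
    rw [← h1.self_of_nhds]
    exact pushforward_mem_of_curve hc S hΦ h0 hX
  have hloc' : ∀ᶠ g in nhds (1 : G), ∀ X ∈ S.V, pushforward (Φ.diffeo g⁻¹) X ∈ S.V :=
    (continuous_inv.tendsto' (1 : G) 1 inv_one).eventually hloc
  intro g
  -- Including $g^{-1}$ in the predicate makes it stable under inversion.
  refine (forall_of_eventually_nhds_one (P := fun g => (∀ X ∈ S.V,
    pushforward (Φ.diffeo g) X ∈ S.V) ∧ ∀ X ∈ S.V, pushforward (Φ.diffeo g⁻¹) X ∈ S.V)
    (fun g h hg hh => ⟨fun X hX => ?_, fun X hX => ?_⟩) (fun g hg => ?_) (hloc.and hloc') g).1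
  · rw [pushforward_mul]
    exact hg.1 _ (hh.1 _ hX)
  · rw [mul_inv_rev, pushforward_mul]
    exact hh.2 _ (hg.2 _ hX)
  · rw [inv_inv]
    exact hg.symm

variable {V : Submodule ℝ (VField n)} [FiniteDimensional ℝ V] (hV : Φ.Preserves V)

/-- The linear automorphism `g_*` of an invariant space of fields. -/
noncomputable def pushOp (g : G) : V →L[ℝ] V :=
  LinearMap.toContinuousLinearMap
    { toFun := fun X => ⟨pushforward (Φ.diffeo g) X, hV g X X.2⟩
      map_add' := fun _ _ => Subtype.ext (pushforward_add _ _ _)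
      map_smul' := fun _ _ => Subtype.ext (pushforward_smul _ _ _) }

lemma pushOp_one (X : V) : pushOp hV 1 X = X := Subtype.ext (Φ.pushforward_one _)

lemma pushOp_mul (g h : G) (X : V) : pushOp hV (g * h) X = pushOp hV g (pushOp hV h X) :=
  Subtype.ext (Φ.pushforward_mul _ _ _)

lemma jetAction_apply (p : ℕ) (g : G) (j : TangentPow p V) (k : Fin (p + 1)) :
    Φ.jetAction hV p g j k = pushOp hV g (j k) := rfl

lemma jetAction_one (p : ℕ) (j : TangentPow p V) : Φ.jetAction hV p 1 j = j :=
  funext fun _ => pushOp_one hV _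

lemma jetAction_mul (p : ℕ) (g h : G) (j : TangentPow p V) :
    Φ.jetAction hV p (g * h) j = Φ.jetAction hV p g (Φ.jetAction hV p h j) :=
  funext fun _ => pushOp_mul hV _ _ _

variable [LieGroup 𝓘(ℝ, 𝔤) ∞ G]

lemma contMDiff_pushOp_apply : ContMDiff (𝓘(ℝ, 𝔤).prod 𝓘(ℝ, V)) 𝓘(ℝ, V) ∞
    fun q : G × V => pushOp hV q.1 q.2 :=
  contMDiff_of_eval fun y => Φ.contMDiff_pushforward_eval y

lemma contMDiff_jetAction (p : ℕ) :
    ContMDiff (𝓘(ℝ, 𝔤).prod 𝓘(ℝ, TangentPow p V)) 𝓘(ℝ, TangentPow p V) ∞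
      fun q : G × TangentPow p V => Φ.jetAction hV p q.1 q.2 := by
  rw [contMDiff_pi_space]
  intro k
  have hk : ContMDiff (𝓘(ℝ, 𝔤).prod 𝓘(ℝ, TangentPow p V)) 𝓘(ℝ, V) ∞
      fun q : G × TangentPow p V => q.2 k :=
    (ContinuousLinearMap.proj (R := ℝ) (φ := fun _ : Fin (p + 1) => V) k).contMDiff.comp
      contMDiff_snd
  exact (contMDiff_pushOp_apply hV).comp (contMDiff_fst.prodMk hk)

lemma contDiff_pushOp_curve {c : ℝ → G} (hc : ContMDiff 𝓘(ℝ, ℝ) 𝓘(ℝ, 𝔤) ∞ c) :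
    ContDiff ℝ ∞ fun t => pushOp hV (c t) := by
  rw [contDiff_clm_apply_iff]
  intro X
  rw [← contMDiff_iff_contDiff]
  exact (contMDiff_pushOp_apply hV).comp (hc.prodMk contMDiff_const)

end LieAction

end Group

/-! ### Jets of products, and jets of prescribed value. -/

section IteratedDeriv

variable {E F : Type*} [NormedAddCommGroup E] [NormedSpace ℝ E]
  [NormedAddCommGroup F] [NormedSpace ℝ F]

lemma ContinuousLinearMap.iteratedDeriv_comp (L : E →L[ℝ] F) {f : ℝ → E} (hf : ContDiff ℝ ∞ f)
    (k : ℕ) (t : ℝ) : iteratedDeriv k (fun s => L (f s)) t = L (iteratedDeriv k f t) := by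
  have := L.iteratedFDeriv_comp_left (hf.contDiffAt (x := t)) (i := k)
    (WithTop.coe_le_coe.2 le_top)
  rw [iteratedDeriv_eq_iteratedFDeriv, iteratedDeriv_eq_iteratedFDeriv]
  change iteratedFDeriv ℝ k (L ∘ f) t _ = _
  rw [this]
  rfl

lemma deriv_pow_div_factorial (p : ℕ) (t : ℝ) :
    HasDerivAt (fun s : ℝ => s ^ (p + 1) / (p + 1).factorial) (t ^ p / p.factorial) t := by
  convert! (hasDerivAt_pow (p + 1) t).div_const ((p + 1).factorial : ℝ) using 1
  rw [Nat.factorial_succ, Nat.cast_mul, add_tsub_cancel_right,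
    mul_div_mul_left _ _ (by exact_mod_cast p.succ_ne_zero)]

/-- The Taylor coefficients of `t ^ p / p! • h t` at `0` up to order `p`. -/
lemma iteratedDeriv_pow_smul (p k : ℕ) (hk : k ≤ p) {h : ℝ → E} (hh : ContDiff ℝ ∞ h) :
    iteratedDeriv k (fun t : ℝ => (t ^ p / p.factorial) • h t) 0 = if k = p then h 0 else 0 := by
  induction p generalizing k h with
  | zero =>
    obtain rfl : k = 0 := Nat.le_zero.1 hk
    simp
  | succ p ih =>
    cases k with
    | zero => simp
    | succ k =>
      -- The derivative has the same shape with $p$ in place of $p+1$, and its new smooth factor has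
      -- the same value at $0$ as `h`.
      have h1 : deriv (fun t : ℝ => (t ^ (p + 1) / (p + 1).factorial) • h t) = fun t : ℝ =>
          (t ^ p / p.factorial) • (h t + (t / (p + 1 : ℝ)) • deriv h t) := by
        funext t
        have := (deriv_pow_div_factorial p t).smul
          (hh.differentiable (by simp) t).hasDerivAt
        refine this.deriv.trans ?_
        rw [smul_add, smul_smul, add_comm]
        congr 2
        rw [Nat.factorial_succ, Nat.cast_mul, pow_succ, Nat.cast_succ, div_mul_div_comm,
          mul_comm (p + 1 : ℝ)]
      have h2 : ContDiff ℝ ∞ fun t : ℝ => h t + (t / (p + 1 : ℝ)) • deriv h t :=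
        hh.add ((contDiff_id.div_const _).smul (contDiff_infty_iff_deriv.1 hh).2)
      rw [iteratedDeriv_succ', h1, ih k (Nat.succ_le_succ_iff.1 hk) h2]
      simp

/-- The product of an operator-valued function vanishing to order `q` with a smooth function
vanishes to order `q`. -/
lemma iteratedDeriv_clm_apply_eq_zero {q : ℕ} {N : ℝ → E →L[ℝ] F} {f : ℝ → E} {t : ℝ}
    (hN : ContDiff ℝ ∞ N) (hf : ContDiff ℝ ∞ f) (h0 : ∀ k < q, iteratedDeriv k N t = 0)
    {k : ℕ} (hk : k < q) : iteratedDeriv k (fun s => N s (f s)) t = 0 := by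
  induction k generalizing q N f with
  | zero =>
    have : N t = 0 := by simpa using h0 0 hk
    simp [this]
  | succ k ih =>
    have hN' := (contDiff_infty_iff_deriv.1 hN).2
    have hf' := (contDiff_infty_iff_deriv.1 hf).2
    have h1 : deriv (fun s => N s (f s)) = fun s => deriv N s (f s) + N s (deriv f s) := by
      funext s
      exact ((hN.differentiable (by simp) s).hasDerivAt.clm_apply
        (hf.differentiable (by simp) s).hasDerivAt).deriv
    have hle : ((k : ℕ∞) : ℕ∞ω) ≤ ∞ := WithTop.coe_le_coe.2 le_top
    rw [iteratedDeriv_succ', h1, iteratedDeriv_fun_add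
      ((hN'.clm_apply hf).contDiffAt.of_le hle) ((hN.clm_apply hf').contDiffAt.of_le hle),
      ih hN' hf (q := k + 1) (fun i hi => ?_) (Nat.lt_succ_self k),
      ih hN hf' h0 ((Nat.lt_succ_self k).trans hk), add_zero]
    rw [← iteratedDeriv_succ']
    exact h0 _ (lt_of_le_of_lt (Nat.succ_le_of_lt hi) hk)

/-- Every finite family of vectors is the family of derivatives of a smooth curve. -/
lemma exists_contDiff_iteratedDeriv_eq [CompleteSpace E] (p : ℕ) (j : Fin p → E)
    (t₀ : ℝ) : ∃ f : ℝ → E, ContDiff ℝ ∞ f ∧ ∀ k : Fin p, iteratedDeriv k f t₀ = j k := by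
  induction p with
  | zero => exact ⟨0, contDiff_const, fun k => k.elim0⟩
  | succ p ih =>
    -- Realise the higher derivatives first, then integrate from `t₀` with initial value `j 0`.
    obtain ⟨f, hf, hfj⟩ := ih (Fin.tail j)
    have hF : ∀ t, HasDerivAt (fun t => j 0 + ∫ s in t₀..t, f s) (f t) t := fun t =>
      (intervalIntegral.integral_hasDerivAt_right (hf.continuous.intervalIntegrable _ _)
        (hf.continuous.stronglyMeasurableAtFilter _ _) hf.continuous.continuousAt).const_add (j 0)
    have hF' := funext fun t => (hF t).deriv
    refine ⟨fun t => j 0 + ∫ s in t₀..t, f s, ?_, fun k => ?_⟩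
    · rw [contDiff_infty_iff_deriv, hF']
      exact ⟨fun t => (hF t).differentiableAt, hf⟩
    · refine Fin.cases ?_ (fun k => ?_) k
      · simp
      · rw [Fin.val_succ, iteratedDeriv_succ', hF', hfj]
        rfl

end IteratedDeriv

/-! ### Invariance of $\varphi_F$ under the two actions. -/

section Invariance

variable {n : ℕ} {𝔤 : Type*} [NormedAddCommGroup 𝔤] [NormedSpace ℝ 𝔤]
  {G : Type*} [TopologicalSpace G] [ChartedSpace 𝔤 G] [Group G] {Φ : LieAction 𝔤 G n}

lemma exists_jet_eq (p : ℕ) {V : Submodule ℝ (VField n)} [FiniteDimensional ℝ V]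
    (j : TangentPow p V) (t : ℝ) : ∃ X : Family V, jet p X t = j := by
  have : CompleteSpace V := FiniteDimensional.complete ℝ V
  obtain ⟨f, hf, hj⟩ := exists_contDiff_iteratedDeriv_eq (p + 1) j t
  exact ⟨⟨f, hf.contMDiff⟩, funext hj⟩

/-- Smooth curves in `G` starting at the neutral element act on the `t`-dependent fields with
values in `V`, and preserve quasi-Lie invariants. -/
lemma exists_star [LieGroup 𝓘(ℝ, 𝔤) ∞ G] {S : Scheme n} (hV : Φ.Preserves S.V) {c : ℝ → G}
    (hc : ContMDiff 𝓘(ℝ, ℝ) 𝓘(ℝ, 𝔤) ∞ c) (h0 : c 0 = 1) {Y : Family S.W}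
    (hY : ∀ t x, HasDerivAt (fun s => Φ.toHom (c s) x)
      ((Y t : VField n) (Φ.toHom (c t) x)) t) (X : Family S.V) :
    ∃ X' : Family S.V,
      (∀ t, X' t = Submodule.inclusion S.le (Y t) + LieAction.pushOp hV (c t) (X t)) ∧
      ∀ F, IsInvariant S F → F X' = F X := by
  have hsm : ContDiff ℝ ∞ fun t =>
      Submodule.inclusion S.le (Y t) + LieAction.pushOp hV (c t) (X t) :=
    ((LinearMap.toContinuousLinearMap (Submodule.inclusion S.le)).contDiff.comp
      Y.contMDiff.contDiff).add
      ((LieAction.contDiff_pushOp_curve hV hc).clm_apply X.contMDiff.contDiff)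
  refine ⟨⟨_, hsm.contMDiff⟩, fun t => rfl, fun F hF => ?_⟩
  refine hF (fun t => Φ.diffeo (c t)) ⟨Y, ⟨LieAction.contDiff_curve hc, fun x => ?_, hY⟩⟩ X _ ?_
  · change Φ.toHom (c 0) x = x
    rw [h0, map_one]
    rfl
  · intro t y
    have h1 := (hY t ((Φ.diffeo (c t)).symm y)).deriv
    have h2 : Φ.toHom (c t) ((Φ.diffeo (c t)).symm y) = y := (Φ.diffeo (c t)).apply_symm_apply y
    rw [h2] at h1
    change (Y t : VField n) y + pushforward (Φ.diffeo (c t)) (X t : VField n) y = _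
    rw [← h1]
    rfl

variable {S : Scheme n} {p : ℕ} {F : Family S.V → SmoothFun} {φ : TangentPow p S.V → ℝ}

lemma IsInvariantOfOrder.apply_jetAction [LieGroup 𝓘(ℝ, 𝔤) ∞ G] [ConnectedSpace G]
    (hΦ : Φ.Integrates S.W) (hF : IsInvariantOfOrder S p F φ) (hV : Φ.Preserves S.V) (g : G)
    (j : TangentPow p S.V) : φ (Φ.jetAction hV p g j) = φ j := by
  have := topologicalGroup_of_lieGroup 𝓘(ℝ, 𝔤) ∞ (G := G)
  refine forall_of_eventually_nhds_one (P := fun g => ∀ j, φ (Φ.jetAction hV p g j) = φ j)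
    (fun g h hg hh j => ?_) (fun g hg j => ?_) ?_ g j
  · rw [LieAction.jetAction_mul, hg, hh]
  · rw [← hg, ← LieAction.jetAction_mul, mul_inv_cancel, LieAction.jetAction_one]
  · filter_upwards [eventually_exists_curve (𝔤 := 𝔤) (1 : G)]
    rintro g ⟨c, hc, h0, h1⟩ j
    obtain ⟨Y, hY⟩ := LieAction.exists_velocityField hc hΦ
    obtain ⟨X, rfl⟩ := exists_jet_eq p j 1
    obtain ⟨X', hX', hFX⟩ := exists_star hV hc h0 hY X
    have hX1 : (fun t => X' t) =ᶠ[nhds 1] fun t => LieAction.pushOp hV g (X t) := by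
      filter_upwards [h1.eventually_nhds] with t ht
      -- The curve is constant near $t$, so its velocity field vanishes.
      have hYt : Y t = 0 := Subtype.ext <| DFunLike.ext _ _ fun x => by
        have h2 := hY t (Φ.toHom (c t)⁻¹ x)
        rw [Φ.smul_inv_smul] at h2
        refine h2.unique ((hasDerivAt_const t (Φ.toHom g (Φ.toHom (c t)⁻¹ x))).congr_of_eventuallyEq
          ?_)
        filter_upwards [ht] with s hs
        rw [hs]
      rw [hX', hYt, map_zero, zero_add, ht.self_of_nhds]
    have hjet : jet p X' 1 = Φ.jetAction hV p g (jet p X 1) := funext fun k => by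
      rw [LieAction.jetAction_apply]
      exact (hX1.iteratedDeriv_eq k).trans
        (ContinuousLinearMap.iteratedDeriv_comp _ X.contMDiff.contDiff _ _)
    rw [← hjet, ← hF.2, ← hF.2, hFX F hF.1]

lemma IsInvariantOfOrder.apply_translationAction [LieGroup 𝓘(ℝ, 𝔤) ∞ G]
    (hΦ : Φ.Integrates S.W) (hF : IsInvariantOfOrder S p F φ) (hV : Φ.Preserves S.V)
    (w : topJets p S.W) (j : TangentPow p S.V) : φ (translationAction S p w j) = φ j := by
  obtain ⟨v, -, hv⟩ := hΦ.surjOn ⟨(w.1 (Fin.last p) : VField n), (w.1 (Fin.last p)).2, rfl⟩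
  obtain ⟨C, hC, hC0, hCv⟩ := exists_curve_velocity (𝔤 := 𝔤) (1 : G) v
  obtain ⟨Z, hZ⟩ := LieAction.exists_velocityField hC hΦ
  have hZ0 : Z 0 = w.1 (Fin.last p) := Subtype.ext <| DFunLike.ext _ _ fun x => by
    have h1 := hasDerivAt_comp_curve (hC.mdifferentiableAt (by simp) (x := 0)) hC0
      (LieAction.mdifferentiableAt_orbit (Φ := Φ) x 1)
    have h2 := hZ 0 x
    rw [hC0, map_one] at h2
    refine (h2.unique h1).trans ?_
    rw [hCv]
    exact congrFun hv x
  -- Chosen so that $\theta'=t^p/p!$, whose only nonzero derivative at $0$ is the $p$-th, equal to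
  -- $1$.
  let θ : ℝ → ℝ := fun t => t ^ (p + 1) / (p + 1).factorial
  have hθ : ContDiff ℝ ∞ θ := (contDiff_id.pow _).div_const _
  have hθ0 : θ 0 = 0 := by simp [θ]
  have hZθ : ContDiff ℝ ∞ fun t => Z (θ t) := Z.contMDiff.contDiff.comp hθ
  let Y : Family S.W := ⟨fun t => (t ^ p / p.factorial : ℝ) • Z (θ t),
    (((contDiff_id.pow _).div_const _).smul hZθ).contMDiff⟩
  have hY : ∀ t x, HasDerivAt (fun s => Φ.toHom (C (θ s)) x)
      ((Y t : VField n) (Φ.toHom (C (θ t)) x)) t := fun t x =>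
    (hZ (θ t) x).scomp t (deriv_pow_div_factorial p t)
  have hc : ContMDiff 𝓘(ℝ, ℝ) 𝓘(ℝ, 𝔤) ∞ fun t => C (θ t) := hC.comp hθ.contMDiff
  obtain ⟨X, rfl⟩ := exists_jet_eq p j 0
  obtain ⟨X', hX', hFX⟩ := exists_star hV hc (by rw [hθ0, hC0]) hY X
  let B : ℝ → S.V →L[ℝ] S.V := fun s => LieAction.pushOp hV (C s)
  have hB : ContDiff ℝ ∞ B := LieAction.contDiff_pushOp_curve hV hC
  let N : ℝ → S.V →L[ℝ] S.V := fun t => B (θ t) - ContinuousLinearMap.id ℝ S.V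
  have hN : ContDiff ℝ ∞ N := (hB.comp hθ).sub contDiff_const
  -- $N'=\theta'\cdot(B'\circ\theta)$ vanishes to order $p$ at $0$ and $N(0)=0$, so `N` does not
  -- affect $p$-jets at $0$.
  have hN0 : ∀ k < p + 1, iteratedDeriv k N 0 = 0 := by
    intro k hk
    cases k with
    | zero =>
      ext1 X
      simp only [iteratedDeriv_zero, N, B, hθ0, hC0]
      exact sub_eq_zero.2 (LieAction.pushOp_one hV X)
    | succ k =>
      have h1 : deriv N = fun t => (t ^ p / p.factorial : ℝ) • deriv B (θ t) := funext fun t =>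
        (((hB.differentiable (by simp) (θ t)).hasDerivAt.scomp t
          (deriv_pow_div_factorial p t)).sub_const _).deriv
      have hkp : k < p := Nat.succ_lt_succ_iff.1 hk
      rw [iteratedDeriv_succ', h1]
      exact (iteratedDeriv_pow_smul p k hkp.le
        ((contDiff_infty_iff_deriv.1 hB).2.comp hθ)).trans (if_neg hkp.ne)
  have hX : ContDiff ℝ ∞ fun t => X t := X.contMDiff.contDiff
  have hYs : ContDiff ℝ ∞ fun t => Y t := Y.contMDiff.contDiff
  let ι : S.W →L[ℝ] S.V := LinearMap.toContinuousLinearMap (Submodule.inclusion S.le)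
  have hX'' : (fun t => X' t) = fun t => (ι (Y t) + X t) + N t (X t) := funext fun t => by
    rw [hX', add_assoc]
    congr 1
    exact (add_sub_cancel (X t) (B (θ t) (X t))).symm
  have hjet : jet p X' 0 = translationAction S p w (jet p X 0) := funext fun k => by
    have hle : (((k : ℕ) : ℕ∞) : ℕ∞ω) ≤ ∞ := WithTop.coe_le_coe.2 le_top
    have hιY : ContDiff ℝ ∞ fun t => ι (Y t) := ι.contDiff.comp hYs
    change iteratedDeriv k (fun t => X' t) 0 =
      Submodule.inclusion S.le (w.1 k) + iteratedDeriv k (fun t => X t) 0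
    rw [hX'', iteratedDeriv_fun_add ((hιY.add hX).contDiffAt.of_le hle)
      ((hN.clm_apply hX).contDiffAt.of_le hle),
      iteratedDeriv_fun_add (hιY.contDiffAt.of_le hle) (hX.contDiffAt.of_le hle),
      iteratedDeriv_clm_apply_eq_zero hN hX hN0 k.2, add_zero,
      ContinuousLinearMap.iteratedDeriv_comp ι hYs]
    congr 1
    change Submodule.inclusion S.le _ = _
    congr 1
    refine (iteratedDeriv_pow_smul p k (Nat.lt_succ_iff.1 k.2) hZθ).trans ?_
    split_ifs with hk
    · rw [hθ0, hZ0, show k = Fin.last p from Fin.ext hk]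
    · exact (w.2 k (lt_of_le_of_ne (Nat.lt_succ_iff.1 k.2) hk)).symm
  rw [← hjet, ← hF.2, ← hF.2, hFX F hF.1]

end Invariance

/-! ### Criteria for first integrals. -/

section FirstIntegral

variable {M : Type*} [NormedAddCommGroup M] [NormedSpace ℝ M]

lemma fderiv_eq_zero_of_curve {φ : M → ℝ} {ψ : ℝ → M} {m w : M} (hψ : HasDerivAt ψ w 0)
    (h0 : ψ 0 = m) (hconst : ∀ s, φ (ψ s) = φ m) (hφ : DifferentiableAt ℝ φ m) :
    fderiv ℝ φ m w = 0 := by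
  subst h0
  have h := hφ.hasFDerivAt.comp_hasDerivAt 0 hψ
  refine h.unique ?_
  have : φ ∘ ψ = fun _ => φ (ψ 0) := funext hconst
  rw [this]
  exact hasDerivAt_const _ _

lemma eq_of_eventually_eq_on_Ioo {f : ℝ → ℝ} {a b : ℝ}
    (h : ∀ t ∈ Set.Ioo a b, ∀ᶠ s in nhds t, f s = f t) :
    ∀ s ∈ Set.Ioo a b, ∀ s' ∈ Set.Ioo a b, f s = f s' := by
  have hd : ∀ t ∈ Set.Ioo a b, HasDerivAt f 0 t := fun t ht =>
    (hasDerivAt_const t (f t)).congr_of_eventuallyEq (h t ht)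
  intro s hs s' hs'
  exact isOpen_Ioo.is_const_of_deriv_eq_zero isPreconnected_Ioo
    (fun t ht => (hd t ht).differentiableAt.differentiableWithinAt) (fun t ht => (hd t ht).deriv)
    hs hs'

/-- A function invariant under the translations by multiples of `w` is a first integral of the
constant vector field `w`. -/
lemma isFirstIntegral_const {φ : M → ℝ} {w : M} (h : ∀ (s : ℝ) m, φ (s • w + m) = φ m) :
    IsFirstIntegral φ fun _ => w where
  const_along a b γ hγ s hs s' hs' := by
    have hd : ∀ t ∈ Set.Ioo a b, HasDerivAt (fun t => γ t - t • w) 0 t := fun t ht => by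
      have h1 := ((hγ t ht).hasDerivAt (isOpen_Ioo.mem_nhds ht)).sub
        ((hasDerivAt_id t).smul_const w)
      rw [one_smul, sub_self] at h1
      exact h1
    have h1 : γ s - s • w = γ s' - s' • w := isOpen_Ioo.is_const_of_deriv_eq_zero
      isPreconnected_Ioo (fun t ht => (hd t ht).differentiableAt.differentiableWithinAt)
      (fun t ht => (hd t ht).deriv) hs hs'
    have h2 : γ s = (s - s') • w + γ s' := by
      rw [sub_smul, ← sub_eq_zero, ← sub_eq_zero.2 h1]
      abel
    rw [h2, h]
  deriv_eq_zero m hφ := by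
    have h1 : HasDerivAt (fun s : ℝ => s • w + m) w 0 := by
      have h2 := ((hasDerivAt_id (0 : ℝ)).smul_const w).add_const m
      rwa [one_smul] at h2
    exact fderiv_eq_zero_of_curve h1 (by simp) (fun s => h s m) hφ

end FirstIntegral

/-! ### Local one-parameter curves in $G$. -/

section IntegralCurve

variable {𝔤 : Type*} [NormedAddCommGroup 𝔤] [NormedSpace ℝ 𝔤] [CompleteSpace 𝔤]
  {G : Type*} [TopologicalSpace G] [ChartedSpace 𝔤 G] [Group G] [LieGroup 𝓘(ℝ, 𝔤) ∞ G]

/-- Local integral curves of the left-invariant vector fields. -/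
lemma exists_leftInvariant_curve (v : GroupLieAlgebra 𝓘(ℝ, 𝔤) G) :
    ∃ c : ℝ → G, c 0 = 1 ∧ ∀ᶠ t in nhds (0 : ℝ), HasMFDerivAt 𝓘(ℝ, ℝ) 𝓘(ℝ, 𝔤) c t
      ((1 : ℝ →L[ℝ] ℝ).smulRight (mulInvariantVectorField v (c t))) := by
  have : LieGroup 𝓘(ℝ, 𝔤) (minSmoothness ℝ 3) G := LieGroup.of_le (n := ∞) (by
    rw [minSmoothness_of_isRCLikeNormedField]
    exact WithTop.coe_le_coe.2 le_top)
  have : IsManifold 𝓘(ℝ, 𝔤) 1 G := IsManifold.of_le (n := ∞) (by simp)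
  refine exists_isMIntegralCurveAt_of_contMDiffAt_boundaryless 0
    ((contMDiffAt_mulInvariantVectorField v).of_le ?_)
  rw [minSmoothness_of_isRCLikeNormedField]
  exact one_le_two

end IntegralCurve

/-! ### Fundamental fields of the jet action. -/

section JetAction

variable {n : ℕ} {𝔤 : Type*} [NormedAddCommGroup 𝔤] [NormedSpace ℝ 𝔤]
  {G : Type*} [TopologicalSpace G] [ChartedSpace 𝔤 G] [Group G]
  {Φ : LieAction 𝔤 G n} {V : Submodule ℝ (VField n)} [FiniteDimensional ℝ V]
  (hV : Φ.Preserves V)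

namespace LieAction

/-- The linear map `𝒥^p(g; ·)`. -/
noncomputable def jetOp (p : ℕ) (g : G) : TangentPow p V →L[ℝ] TangentPow p V :=
  ContinuousLinearMap.pi fun k => (pushOp hV g).comp (ContinuousLinearMap.proj k)

lemma jetOp_apply (p : ℕ) (g : G) (j : TangentPow p V) :
    jetOp hV p g j = Φ.jetAction hV p g j := rfl

variable [LieGroup 𝓘(ℝ, 𝔤) ∞ G]

lemma mdifferentiableAt_jetAction (p : ℕ) (j : TangentPow p V) (g : G) :
    MDifferentiableAt 𝓘(ℝ, 𝔤) 𝓘(ℝ, TangentPow p V) (fun g => Φ.jetAction hV p g j) g :=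
  (((contMDiff_jetAction hV p).comp
    (contMDiff_id.prodMk contMDiff_const)).contMDiffAt).mdifferentiableAt (by simp)

/-- The fundamental vector fields of the jet action are linear. -/
lemma exists_linear_fundamentalField (p : ℕ) (v : GroupLieAlgebra 𝓘(ℝ, 𝔤) G) :
    ∃ L : TangentPow p V →L[ℝ] TangentPow p V,
      ∀ j, fundamentalField (1 : G) (Φ.jetAction hV p) v j = L j := by
  obtain ⟨c, hc, hc0, hcv⟩ := exists_curve_velocity (𝔤 := 𝔤) (1 : G) v
  have hA : ContDiff ℝ ∞ fun s => jetOp hV p (c s) := by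
    rw [contDiff_clm_apply_iff]
    intro j
    rw [← contMDiff_iff_contDiff]
    exact (contMDiff_jetAction hV p).comp (hc.prodMk contMDiff_const)
  refine ⟨deriv (fun s => jetOp hV p (c s)) 0, fun j => ?_⟩
  have h1 := hasDerivAt_comp_curve (hc.mdifferentiableAt (by simp) (x := 0)) hc0
    (mdifferentiableAt_jetAction hV p j 1)
  rw [hcv] at h1
  have h2 := (hA.differentiable (by simp) 0).hasDerivAt.clm_apply (hasDerivAt_const 0 j)
  rw [map_zero, add_zero] at h2
  exact h1.unique h2

/-- Differentiate $\mathcal J^p(c(t)h;j)=\mathcal J^p(c(t);\mathcal J^p(h;j))$ at $h=e$. Left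
invariance keeps the fundamental field at the fixed `j`, the form needed for cancellation against an
integral curve. -/
lemma hasDerivAt_jetAction_of_leftInvariant (p : ℕ) {v : GroupLieAlgebra 𝓘(ℝ, 𝔤) G} {c : ℝ → G}
    {t : ℝ} (hc : HasMFDerivAt 𝓘(ℝ, ℝ) 𝓘(ℝ, 𝔤) c t
      ((1 : ℝ →L[ℝ] ℝ).smulRight (mulInvariantVectorField v (c t)))) (j : TangentPow p V) :
    HasDerivAt (fun s => Φ.jetAction hV p (c s) j)
      (Φ.jetAction hV p (c t) (fundamentalField (1 : G) (Φ.jetAction hV p) v j)) t := by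
  have h1 := hasDerivAt_comp_curve hc.mdifferentiableAt rfl
    (mdifferentiableAt_jetAction hV p j (c t))
  have hvel : velocity (𝔤 := 𝔤) c t = mulInvariantVectorField v (c t) := by
    rw [velocity, hc.mfderiv]
    exact one_smul ℝ (mulInvariantVectorField v (c t) : 𝔤)
  rw [hvel] at h1
  have hmul : MDifferentiableAt 𝓘(ℝ, 𝔤) 𝓘(ℝ, 𝔤) (fun h => c t * h) (1 : G) :=
    ((contMDiff_mul_left (I := 𝓘(ℝ, 𝔤)) (n := ∞) (a := c t)).contMDiffAt).mdifferentiableAt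
      (by simp)
  have h2 := ((mdifferentiableAt_jetAction hV p j (c t * 1)).hasMFDerivAt).comp (1 : G)
    hmul.hasMFDerivAt
  have h3 := ((jetOp hV p (c t)).hasFDerivAt.hasMFDerivAt).comp (1 : G)
    (mdifferentiableAt_jetAction hV p j (1 : G)).hasMFDerivAt
  have h4 : (fun g => Φ.jetAction hV p g j) ∘ (fun h => c t * h) =
      jetOp hV p (c t) ∘ fun g => Φ.jetAction hV p g j :=
    funext fun h => jetAction_mul hV p (c t) h j
  rw [h4] at h2
  have h5 := DFunLike.congr_fun (hasMFDerivAt_unique h3 h2) v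
  rw [mul_one] at h5
  have h6 : Φ.jetAction hV p (c t) (fundamentalField (1 : G) (Φ.jetAction hV p) v j) =
      mfderiv 𝓘(ℝ, 𝔤) 𝓘(ℝ, TangentPow p V) (fun g => Φ.jetAction hV p g j) (c t)
        (mulInvariantVectorField v (c t)) := h5
  rw [h6]
  exact h1

/-- Functions invariant under the jet action are first integrals of its fundamental fields. -/
lemma isFirstIntegral_of_invariant [CompleteSpace 𝔤] {p : ℕ} {φ : TangentPow p V → ℝ}
    (hφ : ∀ g j, φ (Φ.jetAction hV p g j) = φ j) (v : GroupLieAlgebra 𝓘(ℝ, 𝔤) G) :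
    IsFirstIntegral φ (fundamentalField (1 : G) (Φ.jetAction hV p) v) where
  const_along a b γ hγ := by
    obtain ⟨c, hc0, hc⟩ := exists_leftInvariant_curve v
    obtain ⟨L, hL⟩ := exists_linear_fundamentalField hV p v
    refine eq_of_eventually_eq_on_Ioo (f := fun s => φ (γ s)) fun t ht => ?_
    have hγt : ∀ᶠ r in nhds (0 : ℝ), t - r ∈ Set.Ioo a b :=
      ((continuous_const.sub continuous_id).tendsto' (0 : ℝ) t (sub_zero t)).eventually
        (isOpen_Ioo.mem_nhds ht)
    obtain ⟨δ, hδ, hball⟩ := Metric.eventually_nhds_iff_ball.1 (hc.and hγt)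
    -- Moving back along `γ` while acting by `c r` gives derivative $\mathcal
    -- J^p(c(r);L\gamma-L\gamma)=0$; hence $\gamma(t)=\mathcal J^p(c(r);\gamma(t-r))$.
    have hd : ∀ r ∈ Metric.ball (0 : ℝ) δ,
        HasDerivAt (fun r => jetOp hV p (c r) (γ (t - r))) 0 r := fun r hr => by
      obtain ⟨hcr, hγr⟩ := hball r hr
      have h1 : HasDerivAt (fun r => jetOp hV p (c r)) ((jetOp hV p (c r)).comp L) r :=
        hasDerivAt_clm_of_apply fun j => by
          have := hasDerivAt_jetAction_of_leftInvariant hV p hcr j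
          rw [hL] at this
          exact this
      have h2 : HasDerivAt (fun r => γ (t - r)) (-L (γ (t - r))) r := by
        have h3 : HasDerivAt γ (L (γ (t - r))) (t - r) := by
          rw [← hL]
          exact (hγ _ hγr).hasDerivAt (isOpen_Ioo.mem_nhds hγr)
        have h4 := h3.scomp r ((hasDerivAt_id r).const_sub t)
        rwa [neg_one_smul] at h4
      have h5 := h1.clm_apply h2
      rw [map_neg, ContinuousLinearMap.comp_apply, add_neg_cancel] at h5
      exact h5
    have hconst : ∀ r ∈ Metric.ball (0 : ℝ) δ, φ (γ (t - r)) = φ (γ t) := fun r hr => by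
      have h1 := Metric.isOpen_ball.is_const_of_deriv_eq_zero
        (convex_ball (0 : ℝ) δ).isPreconnected
        (fun r hr => (hd r hr).differentiableAt.differentiableWithinAt)
        (fun r hr => (hd r hr).deriv) hr (Metric.mem_ball_self hδ)
      simp only [hc0, sub_zero, jetOp_apply, jetAction_one] at h1
      rw [← h1, hφ]
    have htend : Filter.Tendsto (fun s : ℝ => t - s) (nhds t) (nhds 0) :=
      (continuous_const.sub continuous_id).tendsto' t 0 (sub_self t)
    filter_upwards [htend.eventually (Metric.ball_mem_nhds 0 hδ)] with s hs
    simpa only [sub_sub_cancel] using hconst _ hs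
  deriv_eq_zero j hj := by
    obtain ⟨c, hc, hc0, hcv⟩ := exists_curve_velocity (𝔤 := 𝔤) (1 : G) v
    have h1 := hasDerivAt_comp_curve (hc.mdifferentiableAt (by simp) (x := 0)) hc0
      (mdifferentiableAt_jetAction hV p j 1)
    rw [hcv] at h1
    exact fderiv_eq_zero_of_curve h1 (by rw [hc0, jetAction_one]) (fun s => hφ _ _) hj

end LieAction

end JetAction

/-! ### Fundamental fields of the translation action are constant. -/

section Translation

variable {n : ℕ} (S : Scheme n) (p : ℕ)

lemma fundamentalField_translationAction
    (w : TangentSpace 𝓘(ℝ, topJets p S.W) (0 : topJets p S.W)) (j : TangentPow p S.V) :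
    fundamentalField (0 : topJets p S.W) (translationAction S p) w j =
      translationAction S p w 0 := by
  let L : topJets p S.W →L[ℝ] TangentPow p S.V := LinearMap.toContinuousLinearMap
    { toFun := fun w => translationAction S p w 0
      map_add' := fun w w' => funext fun k => by simp [translationAction]
      map_smul' := fun a w => funext fun k => by simp [translationAction] }
  have h : (fun w => translationAction S p w j) = fun w => L w + j := funext fun w =>
    funext fun k => by simp [L, translationAction]
  have hL : HasFDerivAt (fun w => translationAction S p w j) L 0 := by
    rw [h]
    exact L.hasFDerivAt.add_const j
  rw [fundamentalField, hL.hasMFDerivAt.mfderiv]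
  rfl

end Translation

end QuasiLie

theorem mainTheorem5 {n : ℕ} (S : QuasiLie.Scheme n)
    {𝔤 : Type*} [NormedAddCommGroup 𝔤] [NormedSpace ℝ 𝔤] [FiniteDimensional ℝ 𝔤]
    {G : Type*} [TopologicalSpace G] [T2Space G] [ConnectedSpace G] [ChartedSpace 𝔤 G]
    [Group G] [LieGroup 𝓘(ℝ, 𝔤) ∞ G]
    (Φ : QuasiLie.LieAction 𝔤 G n) (hΦ : Φ.Integrates S.W)
    (p : ℕ) (F : QuasiLie.Family S.V → QuasiLie.SmoothFun)
    (φ : QuasiLie.TangentPow p S.V → ℝ) (hF : QuasiLie.IsInvariantOfOrder S p F φ) :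
    (∃ hV : Φ.Preserves S.V,
      ContMDiff (𝓘(ℝ, 𝔤).prod 𝓘(ℝ, QuasiLie.TangentPow p S.V))
        𝓘(ℝ, QuasiLie.TangentPow p S.V) ∞
        (fun q : G × QuasiLie.TangentPow p S.V => Φ.jetAction hV p q.1 q.2) ∧
      ∀ v : GroupLieAlgebra 𝓘(ℝ, 𝔤) G,
        QuasiLie.IsFirstIntegral φ
          (QuasiLie.fundamentalField (1 : G) (Φ.jetAction hV p) v)) ∧
    ∀ w : TangentSpace 𝓘(ℝ, QuasiLie.topJets p S.W) (0 : QuasiLie.topJets p S.W),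
      QuasiLie.IsFirstIntegral φ
        (QuasiLie.fundamentalField (0 : QuasiLie.topJets p S.W)
          (QuasiLie.translationAction S p) w) := by
  have : CompleteSpace 𝔤 := FiniteDimensional.complete ℝ 𝔤
  have hV := hΦ.preserves
  refine ⟨⟨hV, QuasiLie.LieAction.contMDiff_jetAction hV p,
    QuasiLie.LieAction.isFirstIntegral_of_invariant hV (hF.apply_jetAction hΦ hV)⟩, fun w => ?_⟩
  rw [funext (QuasiLie.fundamentalField_translationAction S p w)]
  refine QuasiLie.isFirstIntegral_const fun s j => ?_
  let w' : QuasiLie.topJets p S.W := w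
  have : s • QuasiLie.translationAction S p w' 0 + j =
      QuasiLie.translationAction S p (s • w') j := funext fun k => by
    simp [QuasiLie.translationAction]
  exact (congrArg φ this).trans (hF.apply_translationAction hΦ hV _ _)
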